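/- Let $p\ge 3$ and let $S=\langle a_1<a_2<\dots<a_p\rangle$ be a numerical semigroup, with $a_1,\dots,a_p$ positive integers satisfying $\gcd(a_1,\dots,a_p)=1$. For $s\in\mathbb N=\{0,1,2,\dots\}$ let $\mathsf Z(s)=\{x\in\mathbb N^p : a_1x_1+\dots+a_px_p=s\}$, let $\mathrm L(x)=x_1+\dots+x_p$ and $\mathcal L(s)=\{\mathrm L(x): x\in\mathsf Z(s)\}$. For $n\in\mathbb N$ put $$\mathsf W(n)=\{s\in S : \exists x\in \mathsf Z(s),\ \mathrm L(x)=n\},\qquad \nu(n)=\bigcup_{s\in \mathsf W(n)}\mathcal L(s).$$ For $A\subseteq\mathbb N$ let $\Delta A$ be the set of differences $m-l$ of consecutive elements $l<m$ of $A$ (no element of $A$ lies strictly between $l$ and $m$). Put $d=\gcd\{a_{i+1}-a_i : 1\le i\le p-1\}$ and, for $2\le i\le p-1$, $g_i=\gcd(a_i-a_1,a_1-a_p,a_p-a_i)$, $$S_i=-\frac{a_2\bigl(a_1dg_i+(p-2)(a_1-a_i)(a_1-a_p)\bigr)}{(a_1-a_2)g_i},\qquad S_i'=\frac{a_{p-1}\bigl((p-2)(a_1-a_p)(a_p-a_i)-da_pg_i\bigr)}{(a_{p-1}-a_p)g_i},$$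 $$N_S=\Bigl\lceil\max\bigl(\{S_i: 2\le i\le p-1\}\cup\{S_i': 2\le i\le p-1\}\bigr)\Bigr\rceil .$$ Let $$C_1=\frac{(a_p-a_{p-1})N_S}{a_{p-1}},\quad C_2=\frac{(a_1-a_2)N_S}{a_2},\quad C_3=\Bigl(-\frac{a_p}{a_1}+\frac{a_p}{a_2}-\frac{a_p}{a_{p-1}}+1\Bigr)N_S,\quad C_4=\Bigl(\frac{a_1}{a_{p-1}}-\frac{a_1}{a_p}-\frac{a_1}{a_2}+1\Bigr)N_S,$$ $$\lambda_1=\max(C_1,C_4),\quad \lambda_2=-\min(C_2,C_3),\quad N_0=\max\Bigl(\frac{N_S}{a_1},\ \frac{a_p-a_1+\lambda_1+\lambda_2}{a_p-a_1}\Bigr).$$ Define the three zones of $\nu(n)$ by $$B_1(n)=\Bigl\{x\in\nu(n): x>\frac{na_p-\lambda_2}{a_1}\Bigr\},\quad B_3(n)=\Bigl\{x\in\nu(n): x<\frac{na_1+\lambda_1}{a_p}\Bigr\},\quad B_2(n)=\nu(n)\setminus(B_1(n)\cup B_3(n)).$$ Then for every $n\in\mathbb N$ with $n\ge N_0$, every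 $\mu\in\mathbb N$ and every $i\in\{1,\dots,p\}$, $$\Delta B_1(n)=\Delta B_1(n+\mu a_1),\qquad \Delta B_3(n)=\Delta B_3(n+\mu a_p),\qquad \Delta B_2(n)=\Delta B_2(n+\mu a_i)=\{d\}.$$ -/

import Mathlib

namespace NumericalSemigroup

variable {p : ℕ}

/-- The monoid `⟨a₁, …, a_p⟩` of all natural combinations of the generators. -/
def monoid (a : Fin p → ℕ) : AddSubmonoid ℕ := AddSubmonoid.closure (Set.range a)

/-- The set `Z(s)` of factorizations of `s`. -/
def factorizations (a : Fin p → ℕ) (s : ℕ) : Set (Fin p → ℕ) :=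
  {x | ∑ i, a i * x i = s}

/-- The length `x₁ + ⋯ + x_p` of a factorization. -/
def length (x : Fin p → ℕ) : ℕ := ∑ i, x i

/-- The set of lengths of `s`. -/
def lengthSet (a : Fin p → ℕ) (s : ℕ) : Set ℕ := length '' factorizations a s

/-- `W(n)`: the elements of the monoid having a factorization of length `n`. -/
def W (a : Fin p → ℕ) (n : ℕ) : Set ℕ :=
  {s | s ∈ monoid a ∧ ∃ x ∈ factorizations a s, length x = n}

/-- `ν(n)`: the union of the sets of lengths of the elements of `W(n)`. -/
def nu (a : Fin p → ℕ) (n : ℕ) : Set ℕ := ⋃ s ∈ W a n, lengthSet a s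

/-- `Δ A`: the set of differences of consecutive elements of `A`. -/
def delta (A : Set ℕ) : Set ℕ :=
  {k | ∃ l ∈ A, ∃ m ∈ A, l < m ∧ (∀ z ∈ A, ¬ (l < z ∧ z < m)) ∧ k = m - l}

/-- The smallest generator `a₁`. -/
def aFirst (hp : 3 ≤ p) (a : Fin p → ℕ) : ℕ := a ⟨0, by omega⟩

/-- The second generator `a₂`. -/
def aSecond (hp : 3 ≤ p) (a : Fin p → ℕ) : ℕ := a ⟨1, by omega⟩

/-- The last but one generator `a_{p-1}`. -/
def aPenult (hp : 3 ≤ p) (a : Fin p → ℕ) : ℕ := a ⟨p - 2, by omega⟩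

/-- The largest generator `a_p`. -/
def aLast (hp : 3 ≤ p) (a : Fin p → ℕ) : ℕ := a ⟨p - 1, by omega⟩

/-- `d = gcd {a_{i+1} - a_i}`; the generators increase, so the subtraction does not truncate. -/
def d (a : Fin p → ℕ) : ℕ :=
  (Finset.univ : Finset (Fin (p - 1))).gcd
    fun i => a ⟨i.val + 1, by omega⟩ - a ⟨i.val, by omega⟩

/-- `gcd (a_i - a₁, a₁ - a_p, a_p - a_i)`. -/
def tripleGcd (hp : 3 ≤ p) (a : Fin p → ℕ) (i : Fin p) : ℕ :=
  Int.gcd ((a i : ℤ) - aFirst hp a)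
    (Int.gcd ((aFirst hp a : ℤ) - aLast hp a) ((aLast hp a : ℤ) - a i))

/-- The rational number `S_i`. -/
def Sval (hp : 3 ≤ p) (a : Fin p → ℕ) (i : Fin p) : ℚ :=
  -((aSecond hp a : ℚ) *
      ((aFirst hp a : ℚ) * d a * tripleGcd hp a i +
        ((p : ℚ) - 2) * ((aFirst hp a : ℚ) - a i) * ((aFirst hp a : ℚ) - aLast hp a)) /
    (((aFirst hp a : ℚ) - aSecond hp a) * tripleGcd hp a i))

/-- The rational number `S'_i`. -/
def Sval' (hp : 3 ≤ p) (a : Fin p → ℕ) (i : Fin p) : ℚ :=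
  ((aPenult hp a : ℚ) *
      (((p : ℚ) - 2) * ((aFirst hp a : ℚ) - aLast hp a) * ((aLast hp a : ℚ) - a i) -
        (d a : ℚ) * aLast hp a * tripleGcd hp a i)) /
    (((aPenult hp a : ℚ) - aLast hp a) * tripleGcd hp a i)

/-- The indices `2, …, p - 1` (shifted by one, as `Fin p` starts at `0`). -/
def inner (p : ℕ) : Finset (Fin p) :=
  Finset.univ.filter fun i => 1 ≤ i.val ∧ i.val + 1 < p

theorem inner_nonempty (hp : 3 ≤ p) : (inner p).Nonempty :=
  ⟨⟨1, by omega⟩, by simp only [inner, Finset.mem_filter, Finset.mem_univ, true_and]; omega⟩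

/-- `N_S`: the ceiling of the maximum of all `S_i` and `S'_i`, `2 ≤ i ≤ p - 1`. -/
def NS (hp : 3 ≤ p) (a : Fin p → ℕ) : ℤ :=
  ⌈(inner p).sup' (inner_nonempty hp) fun i => max (Sval hp a i) (Sval' hp a i)⌉

def C1 (hp : 3 ≤ p) (a : Fin p → ℕ) : ℚ :=
  ((aLast hp a : ℚ) - aPenult hp a) * NS hp a / aPenult hp a

def C2 (hp : 3 ≤ p) (a : Fin p → ℕ) : ℚ :=
  ((aFirst hp a : ℚ) - aSecond hp a) * NS hp a / aSecond hp a

def C3 (hp : 3 ≤ p) (a : Fin p → ℕ) : ℚ :=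
  (-((aLast hp a : ℚ) / aFirst hp a) + (aLast hp a : ℚ) / aSecond hp a
    - (aLast hp a : ℚ) / aPenult hp a + 1) * NS hp a

def C4 (hp : 3 ≤ p) (a : Fin p → ℕ) : ℚ :=
  ((aFirst hp a : ℚ) / aPenult hp a - (aFirst hp a : ℚ) / aLast hp a
    - (aFirst hp a : ℚ) / aSecond hp a + 1) * NS hp a

def lambda1 (hp : 3 ≤ p) (a : Fin p → ℕ) : ℚ := max (C1 hp a) (C4 hp a)

def lambda2 (hp : 3 ≤ p) (a : Fin p → ℕ) : ℚ := -min (C2 hp a) (C3 hp a)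

/-- The bound `N₀`. -/
def N0 (hp : 3 ≤ p) (a : Fin p → ℕ) : ℚ :=
  max ((NS hp a : ℚ) / aFirst hp a)
    (((aLast hp a : ℚ) - aFirst hp a + lambda1 hp a + lambda2 hp a) /
      ((aLast hp a : ℚ) - aFirst hp a))

/-- The zone `B₁(n)` of long lengths. -/
def B1 (hp : 3 ≤ p) (a : Fin p → ℕ) (n : ℕ) : Set ℕ :=
  {x | x ∈ nu a n ∧ ((n : ℚ) * aLast hp a - lambda2 hp a) / aFirst hp a < (x : ℚ)}

/-- The zone `B₃(n)` of short lengths. -/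
def B3 (hp : 3 ≤ p) (a : Fin p → ℕ) (n : ℕ) : Set ℕ :=
  {x | x ∈ nu a n ∧ (x : ℚ) < ((n : ℚ) * aFirst hp a + lambda1 hp a) / aLast hp a}

/-- The middle zone `B₂(n)`. -/
def B2 (hp : 3 ≤ p) (a : Fin p → ℕ) (n : ℕ) : Set ℕ :=
  nu a n \ (B1 hp a n ∪ B3 hp a n)

end NumericalSemigroup

/-! Subtracting `a₁` from every generator turns a factorization of `s` of length `n` into a way of
writing `s - n a₁` as a sum of exactly `n` terms from `{0, a_i - a₁, D}`, where `D = a_p - a₁`. This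
is `BoundedRep`, and by `mem_nu_iff` `m ∈ ν(n)` says that one `s` works for both `n` and `m`, a
condition symmetric in `n` and `m`.

Such `n`-fold sums have a rigid shape. Since `D / g_i` copies of `a_i - a₁` can be traded for `(a_i
- a₁) / g_i` copies of `D`, coefficients reduce to a bounded range. With `E = headBound` and `F =
tailBound`, every multiple of `d` in `[E, nD - F]` is a sum, while the initial and final parts do
not depend on `n` (`BoundedRep.change_head`, `BoundedRep.change_tail`).

For a long length `m`, the admissible `s` lie in `[m a₁, n a_p]`, so the final part of the `n`-sums
meets the initial part of the `m`-sums. The outcome depends only on `n a_p - m a₁`, which `(n, m) ↦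
(n + μ a₁, m + μ a_p)` preserves. Hence `B₁` is translated (`B1_add`), and by symmetry so is `B₃`
(`B3_add`); translation leaves `Δ` unchanged. In the middle zone some `s` falls where no sum is
missing, so `B₂(n)` consists of all `m ≡ n` mod `d` in an interval (`mem_B2_iff`). The constants
`λ₁`, `λ₂`, `N₀` enter only through the inequalities of `zone_bounds`. -/

namespace NumericalSemigroup

/-! ### Structure of the sums of `n` terms from `{0, e_i, D}`. -/

section BoundedRep

variable {ι : Type*} {I : Finset ι} {e g : ι → ℤ} {D n n' h : ℤ}

/-- `h` is a sum of at most `n` terms taken from the `e i`, `i ∈ I`, and `D`. -/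
def BoundedRep (I : Finset ι) (e : ι → ℤ) (D n h : ℤ) : Prop :=
  ∃ (y : ι → ℤ) (j k : ℤ), (∀ i ∈ I, 0 ≤ y i) ∧ 0 ≤ j ∧ 0 ≤ k ∧
    j + ∑ i ∈ I, y i + k = n ∧ ∑ i ∈ I, y i * e i + k * D = h

/-- An upper bound for `∑ y i * e i` when `y i < D / g i`. -/
def reducedBound (I : Finset ι) (e g : ι → ℤ) (D : ℤ) : ℤ := ∑ i ∈ I, D / g i * e i

/-- Replacing each term `t` by `D - t` exchanges the zeros with the copies of `D`. It lets
statements about the end of the range be deduced from those about its beginning. -/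
theorem BoundedRep.reflect (H : BoundedRep I e D n h) :
    BoundedRep I (fun i => D - e i) D n (n * D - h) := by
  obtain ⟨y, j, k, hy, hj, hk, hs, hh⟩ := H
  refine ⟨y, k, j, hy, hk, hj, by linarith, ?_⟩
  simp only [mul_sub, Finset.sum_sub_distrib, ← Finset.sum_mul]
  rw [← hs, ← hh]
  ring

theorem BoundedRep.nonneg (H : BoundedRep I e D n h) (he : ∀ i ∈ I, 0 ≤ e i) (hD : 0 ≤ D) :
    0 ≤ h := by
  obtain ⟨y, j, k, hy, -, hk, -, rfl⟩ := H
  exact add_nonneg (Finset.sum_nonneg fun i hi => mul_nonneg (hy i hi) (he i hi))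
    (mul_nonneg hk hD)

theorem sum_mul_le_reducedBound {y : ι → ℤ} (he : ∀ i ∈ I, 0 ≤ e i)
    (hy : ∀ i ∈ I, y i < D / g i) : ∑ i ∈ I, y i * e i ≤ reducedBound I e g D :=
  Finset.sum_le_sum fun i hi => mul_le_mul_of_nonneg_right (hy i hi).le (he i hi)

theorem reducedBound_nonneg (hD : 0 < D) (hg : ∀ i ∈ I, 0 < g i) (he : ∀ i ∈ I, 0 ≤ e i) :
    0 ≤ reducedBound I e g D :=
  Finset.sum_nonneg fun i hi => mul_nonneg (Int.ediv_nonneg hD.le (hg i hi).le) (he i hi)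

/-- Coefficients of the `e i` can be reduced modulo `D / g i`, at the expense of that of `D`. -/
theorem exists_reduced (hD : 0 < D) (hg : ∀ i ∈ I, 0 < g i) (hgD : ∀ i ∈ I, g i ∣ D)
    (hge : ∀ i ∈ I, g i ∣ e i) (z : ι → ℤ) (c : ℤ) :
    ∃ (y : ι → ℤ) (k : ℤ), (∀ i ∈ I, 0 ≤ y i ∧ y i < D / g i) ∧
      ∑ i ∈ I, y i * e i + k * D = ∑ i ∈ I, z i * e i + c * D ∧
      ((∀ i ∈ I, 0 ≤ e i) → (∀ i ∈ I, 0 ≤ z i) → c ≤ k) := by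
  have hq : ∀ i ∈ I, 0 < D / g i := fun i hi =>
    Int.ediv_pos_of_pos_of_dvd hD (hg i hi).le (hgD i hi)
  -- The quotient of `z i` by `D / g i` is paid in copies of `D`, because `(D / g i) * e i = (e i /
  -- g i) * D`.
  refine ⟨fun i => z i % (D / g i), c + ∑ i ∈ I, z i / (D / g i) * (e i / g i), ?_, ?_, ?_⟩
  · exact fun i hi => ⟨Int.emod_nonneg _ (hq i hi).ne', Int.emod_lt_of_pos _ (hq i hi)⟩
  · have key : ∀ i ∈ I, z i * e i =
        z i % (D / g i) * e i + z i / (D / g i) * (e i / g i) * D := by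
      intro i hi
      have h1 := Int.emod_add_mul_ediv (z i) (D / g i)
      have h2 := Int.ediv_mul_cancel (hgD i hi)
      have h3 := Int.ediv_mul_cancel (hge i hi)
      calc z i * e i = (z i % (D / g i) + D / g i * (z i / (D / g i))) * e i := by rw [h1]
        _ = z i % (D / g i) * e i + z i / (D / g i) * (D / g i) * e i := by ring
        _ = z i % (D / g i) * e i + z i / (D / g i) * (D / g i) * (e i / g i * g i) := by rw [h3]
        _ = z i % (D / g i) * e i + z i / (D / g i) * (e i / g i) * (D / g i * g i) := by ring
        _ = _ := by rw [h2]
    rw [Finset.sum_congr rfl key, Finset.sum_add_distrib, ← Finset.sum_mul]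
    ring
  · intro he hz
    have : 0 ≤ ∑ i ∈ I, z i / (D / g i) * (e i / g i) := Finset.sum_nonneg fun i hi =>
      mul_nonneg (Int.ediv_nonneg (hz i hi) (hq i hi).le) (Int.ediv_nonneg (he i hi) (hg i hi).le)
    linarith

/-- The number `j` of zeros is forced, and only its sign is in question: `j * D = n * D - h - ∑ y i
* (D - e i)`, where the last sum is at most the reduced bound of the reflected differences. -/
theorem boundedRep_of_reduced (hD : 0 < D) (heD : ∀ i ∈ I, e i ≤ D) {y : ι → ℤ} {k : ℤ}
    (hy : ∀ i ∈ I, 0 ≤ y i ∧ y i < D / g i) (hk : 0 ≤ k)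
    (hh : ∑ i ∈ I, y i * e i + k * D = h)
    (hn : h + reducedBound I (fun i => D - e i) g D ≤ n * D) : BoundedRep I e D n h := by
  refine ⟨y, n - ∑ i ∈ I, y i - k, k, fun i hi => (hy i hi).1, ?_, hk, by ring, hh⟩
  have h1 : ∑ i ∈ I, y i * (D - e i) ≤ reducedBound I (fun i => D - e i) g D :=
    sum_mul_le_reducedBound (fun i hi => sub_nonneg.2 (heD i hi)) fun i hi => (hy i hi).2
  simp only [mul_sub, Finset.sum_sub_distrib, ← Finset.sum_mul] at h1
  have h2 : 0 ≤ (n - ∑ i ∈ I, y i - k) * D := by linarith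
  exact nonneg_of_mul_nonneg_left h2 hD

/-- The initial part of the set of sums of `n` terms does not depend on `n`. -/
theorem BoundedRep.change_head (hD : 0 < D) (hg : ∀ i ∈ I, 0 < g i) (hgD : ∀ i ∈ I, g i ∣ D)
    (hge : ∀ i ∈ I, g i ∣ e i) (he : ∀ i ∈ I, 0 ≤ e i) (heD : ∀ i ∈ I, e i ≤ D)
    (H : BoundedRep I e D n h)
    (hn : h + reducedBound I (fun i => D - e i) g D ≤ n' * D) : BoundedRep I e D n' h := by
  obtain ⟨z, j, c, hz, -, hc, -, hh⟩ := H
  obtain ⟨y, k, hy, hs, hck⟩ := exists_reduced hD hg hgD hge z c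
  exact boundedRep_of_reduced hD heD hy (hc.trans (hck he hz)) (hs.trans hh) hn

/-- The final part of the set of sums of `n` terms does not depend on `n`. -/
theorem BoundedRep.change_tail (hD : 0 < D) (hg : ∀ i ∈ I, 0 < g i) (hgD : ∀ i ∈ I, g i ∣ D)
    (hge : ∀ i ∈ I, g i ∣ e i) (he : ∀ i ∈ I, 0 ≤ e i) (heD : ∀ i ∈ I, e i ≤ D) {t : ℤ}
    (H : BoundedRep I e D n (n * D - t))
    (hn : t + reducedBound I e g D ≤ n' * D) : BoundedRep I e D n' (n' * D - t) := by
  have H1 := H.reflect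
  rw [sub_sub_cancel] at H1
  have H2 := (H1.change_head (n' := n') hD hg hgD (fun i hi => dvd_sub (hgD i hi) (hge i hi))
    (fun i hi => sub_nonneg.2 (heD i hi)) (fun i hi => sub_le_self _ (he i hi))
    (by simpa using hn)).reflect
  simpa using H2

/-- The middle part of the set of sums of `n` terms has no gaps. -/
theorem boundedRep_of_mem_middle (hD : 0 < D) (hg : ∀ i ∈ I, 0 < g i) (hgD : ∀ i ∈ I, g i ∣ D)
    (hge : ∀ i ∈ I, g i ∣ e i) (he : ∀ i ∈ I, 0 ≤ e i) (heD : ∀ i ∈ I, e i ≤ D)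
    (hspan : ∃ (z : ι → ℤ) (c : ℤ), ∑ i ∈ I, z i * e i + c * D = h)
    (hh : reducedBound I e g D ≤ h)
    (hn : h + reducedBound I (fun i => D - e i) g D ≤ n * D) : BoundedRep I e D n h := by
  obtain ⟨z, c, hzc⟩ := hspan
  obtain ⟨y, k, hy, hs, -⟩ := exists_reduced hD hg hgD hge z c
  have h1 := sum_mul_le_reducedBound he fun i hi => (hy i hi).2
  have h2 : 0 ≤ k * D := by linarith
  exact boundedRep_of_reduced hD heD hy (nonneg_of_mul_nonneg_left h2 hD) (hs.trans hzc) hn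

end BoundedRep

theorem delta_image_add (A : Set ℕ) (c : ℕ) : delta ((· + c) '' A) = delta A := by
  ext k
  constructor
  · rintro ⟨_, ⟨l, hl, rfl⟩, _, ⟨m, hm, rfl⟩, hlm, hz, rfl⟩
    refine ⟨l, hl, m, hm, by simpa using hlm, fun z hzA hlz => ?_, Nat.add_sub_add_right ..⟩
    exact hz (z + c) ⟨z, hzA, rfl⟩ ⟨by simpa using hlz.1, by simpa using hlz.2⟩
  · rintro ⟨l, hl, m, hm, hlm, hz, rfl⟩
    refine ⟨_, ⟨l, hl, rfl⟩, _, ⟨m, hm, rfl⟩, by simpa using hlm, ?_,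
      (Nat.add_sub_add_right ..).symm⟩
    rintro _ ⟨z, hzA, rfl⟩ h
    exact hz z hzA ⟨by simpa using h.1, by simpa using h.2⟩

/-! ### Factorizations as sums of differences of generators. -/

section Generators

variable {p : ℕ}

/-- `a_i - a₁`. -/
def headDiff (hp : 3 ≤ p) (a : Fin p → ℕ) (i : Fin p) : ℤ := (a i : ℤ) - aFirst hp a

/-- `a_p - a₁`. -/
def totalDiff (hp : 3 ≤ p) (a : Fin p → ℕ) : ℤ := (aLast hp a : ℤ) - aFirst hp a

theorem sum_eq_first_add_inner_add_last {M : Type*} [AddCommMonoid M] (hp : 3 ≤ p)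
    (f : Fin p → M) :
    ∑ i, f i = f ⟨0, by omega⟩ + ∑ i ∈ inner p, f i + f ⟨p - 1, by omega⟩ := by
  have h1 : (Finset.univ : Finset (Fin p)) =
      insert ⟨0, by omega⟩ (insert ⟨p - 1, by omega⟩ (inner p)) := by
    ext i
    simp only [inner, Finset.mem_univ, Finset.mem_insert, Finset.mem_filter, Fin.ext_iff, true_and,
      true_iff]
    omega
  rw [h1, Finset.sum_insert, Finset.sum_insert, add_assoc, add_comm (f ⟨p - 1, _⟩)]
  · simp only [inner, Finset.mem_filter]
    omega
  · simp only [inner, Finset.mem_insert, Finset.mem_filter, Fin.ext_iff]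
    omega

theorem card_inner (hp : 3 ≤ p) : (inner p).card = p - 2 := by
  have := sum_eq_first_add_inner_add_last hp (fun _ => 1)
  simp at this
  omega

theorem boundedRep_of_factorization (hp : 3 ≤ p) (a : Fin p → ℕ) {n s : ℕ} {x : Fin p → ℕ}
    (hx : x ∈ factorizations a s) (hl : length x = n) :
    BoundedRep (inner p) (headDiff hp a) (totalDiff hp a) n ((s : ℤ) - n * aFirst hp a) := by
  refine ⟨fun i => x i, x ⟨0, by omega⟩, x ⟨p - 1, by omega⟩, fun _ _ => by positivity,
    by positivity, by positivity, ?_, ?_⟩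
  · rw [← hl, length, sum_eq_first_add_inner_add_last hp]
    push_cast
    rfl
  · have hx' : ∑ i, a i * x i = s := hx
    rw [← hl, length, ← hx']
    push_cast
    have h := sum_eq_first_add_inner_add_last hp fun i => (x i : ℤ) * headDiff hp a i
    have h0 : headDiff hp a ⟨0, by omega⟩ = 0 := sub_self _
    have h1 : headDiff hp a ⟨p - 1, by omega⟩ = totalDiff hp a := rfl
    rw [h0, h1, mul_zero, zero_add] at h
    rw [← h, Finset.sum_mul, ← Finset.sum_sub_distrib]
    exact Finset.sum_congr rfl fun i _ => by rw [headDiff]; ring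

theorem BoundedRep.exists_factorization {hp : 3 ≤ p} {a : Fin p → ℕ} {n : ℕ} {s : ℤ}
    (H : BoundedRep (inner p) (headDiff hp a) (totalDiff hp a) n (s - n * aFirst hp a)) :
    ∃ x : Fin p → ℕ, (∑ i, a i * x i : ℕ) = s ∧ length x = n := by
  obtain ⟨y, j, k, hy, hj, hk, hn, hs⟩ := H
  let w : Fin p → ℤ := fun i => if i.val = 0 then j else if i.val = p - 1 then k else y i
  have hw : ∀ i ∈ inner p, w i = y i := by
    intro i hi
    simp only [inner, Finset.mem_filter] at hi
    simp only [w]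
    rw [if_neg (by omega), if_neg (by omega)]
  have hw0 : w ⟨0, by omega⟩ = j := by simp [w]
  have hw1 : w ⟨p - 1, by omega⟩ = k := by
    simp only [w]
    rw [if_neg (by omega), if_pos trivial]
  have hpos : ∀ i, 0 ≤ w i := by
    intro i
    by_cases h0 : i.val = 0
    · simpa [w, h0] using hj
    by_cases h1 : i.val = p - 1
    · simp only [w, if_neg h0, if_pos h1]; exact hk
    · have hi : i ∈ inner p := by
        simp only [inner, Finset.mem_filter, Finset.mem_univ, true_and]; omega
      rw [hw i hi]; exact hy i hi
  have hsum : ∑ i, w i = n := by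
    rw [sum_eq_first_add_inner_add_last hp, hw0, hw1, Finset.sum_congr rfl hw, hn]
  refine ⟨fun i => (w i).toNat, ?_, ?_⟩
  · have h1 : ∑ i, w i * headDiff hp a i = s - n * aFirst hp a := by
      rw [sum_eq_first_add_inner_add_last hp, hw0, hw1,
        Finset.sum_congr rfl fun i hi => by rw [hw i hi], ← hs]
      simp [headDiff, totalDiff, aFirst, aLast]
    simp only [headDiff, mul_sub, Finset.sum_sub_distrib, ← Finset.sum_mul, hsum] at h1
    push_cast
    simp only [Int.toNat_of_nonneg (hpos _)]
    rw [Finset.sum_congr rfl fun i _ => mul_comm _ _]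
    linarith
  · zify
    simp only [length]
    push_cast
    simp only [Int.toNat_of_nonneg (hpos _), hsum]

theorem mem_nu_iff (hp : 3 ≤ p) (a : Fin p → ℕ) (n m : ℕ) :
    m ∈ nu a n ↔ ∃ s : ℤ,
      BoundedRep (inner p) (headDiff hp a) (totalDiff hp a) n (s - n * aFirst hp a) ∧
      BoundedRep (inner p) (headDiff hp a) (totalDiff hp a) m (s - m * aFirst hp a) := by
  constructor
  · intro h
    simp only [nu, Set.mem_iUnion] at h
    obtain ⟨s, ⟨-, x, hx, hxl⟩, y, hy, hyl⟩ := h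
    exact ⟨s, boundedRep_of_factorization hp a hx hxl, boundedRep_of_factorization hp a hy hyl⟩
  · rintro ⟨s, hn, hm⟩
    obtain ⟨x, hx, hxl⟩ := hn.exists_factorization
    obtain ⟨y, hy, hyl⟩ := hm.exists_factorization
    simp only [nu, Set.mem_iUnion]
    refine ⟨∑ i, a i * x i, ⟨?_, x, rfl, hxl⟩, y, ?_, hyl⟩
    · refine sum_mem fun i _ => ?_
      have hi : a i ∈ monoid a := AddSubmonoid.subset_closure (Set.mem_range_self i)
      rw [mul_comm, ← smul_eq_mul]
      exact AddSubmonoid.nsmul_mem _ hi _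
    · have : (∑ i, a i * y i : ℕ) = (∑ i, a i * x i : ℕ) := by exact_mod_cast hy.trans hx.symm
      exact this

/-! ### The role of `d`: the ideal generated by the differences, and congruence of lengths. -/

section Divisibility

theorem d_dvd_headDiff (hp : 3 ≤ p) {a : Fin p → ℕ} (ha : StrictMono a) (i : Fin p) :
    (d a : ℤ) ∣ headDiff hp a i := by
  obtain ⟨i, hi⟩ := i
  induction i with
  | zero => simp [headDiff, aFirst]
  | succ i ih =>
    have h1 : d a ∣ a ⟨i + 1, hi⟩ - a ⟨i, by omega⟩ :=
      Finset.gcd_dvd (f := fun i : Fin (p - 1) => a ⟨i.val + 1, by omega⟩ - a ⟨i.val, by omega⟩)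
        (Finset.mem_univ (⟨i, by omega⟩ : Fin (p - 1)))
    have h2 : a ⟨i, by omega⟩ ≤ a ⟨i + 1, hi⟩ := ha.monotone (by simp)
    have h3 := dvd_add (Int.natCast_dvd_natCast.2 h1) (ih (by omega))
    rw [Nat.cast_sub h2] at h3
    simpa [headDiff] using h3

theorem exists_combination (hp : 3 ≤ p) {a : Fin p → ℕ} (ha : StrictMono a) {h : ℤ}
    (hd : (d a : ℤ) ∣ h) :
    ∃ (z : Fin p → ℤ) (c : ℤ), ∑ i ∈ inner p, z i * headDiff hp a i + c * totalDiff hp a = h := by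
  have hmem : h ∈ Ideal.span (Set.range (headDiff hp a)) := by
    rw [← Ideal.span_singleton_generator (Ideal.span (Set.range (headDiff hp a))),
      Ideal.mem_span_singleton]
    -- The generator of the ideal divides every `a_i - a₁`, hence all consecutive differences, hence
    -- their gcd `d`.
    refine dvd_trans ?_ hd
    rw [← Int.natAbs_dvd, Int.natCast_dvd_natCast]
    refine Finset.dvd_gcd fun i _ => ?_
    have hgen : ∀ i, Submodule.IsPrincipal.generator (Ideal.span (Set.range (headDiff hp a))) ∣
        headDiff hp a i := fun i => by
      rw [← Ideal.mem_span_singleton, Ideal.span_singleton_generator]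
      exact Ideal.subset_span ⟨i, rfl⟩
    have h2 : a ⟨i.val, by omega⟩ ≤ a ⟨i.val + 1, by omega⟩ := ha.monotone (by simp)
    have h3 := dvd_sub (hgen ⟨i.val + 1, by omega⟩) (hgen ⟨i.val, by omega⟩)
    rw [← Int.natCast_dvd_natCast, Int.natAbs_dvd, Nat.cast_sub h2]
    simpa [headDiff] using h3
  rw [Ideal.mem_span_range_iff_exists_fun] at hmem
  obtain ⟨z, hz⟩ := hmem
  refine ⟨z, z ⟨p - 1, by omega⟩, ?_⟩
  rw [sum_eq_first_add_inner_add_last hp] at hz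
  rw [← hz]
  simp [headDiff, totalDiff, aFirst, aLast]

/-- A common divisor of `d` and `a₁` divides every `a_i = (a_i - a₁) + a₁`. Coprimality is what
allows `a₁` to be cancelled from `d ∣ (m - n) a₁`. -/
theorem isCoprime_d_aFirst (hp : 3 ≤ p) {a : Fin p → ℕ} (ha : StrictMono a)
    (hgcd : Finset.univ.gcd a = 1) : IsCoprime (d a : ℤ) (aFirst hp a : ℤ) := by
  rw [Nat.isCoprime_iff_coprime, Nat.coprime_iff_gcd_eq_one, ← Nat.dvd_one, ← hgcd]
  refine Finset.dvd_gcd fun i _ => ?_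
  have h1 := (Int.natCast_dvd_natCast.2 (Nat.gcd_dvd_left (d a) (aFirst hp a))).trans
    (d_dvd_headDiff hp ha i)
  have h2 := dvd_add h1 (Int.natCast_dvd_natCast.2 (Nat.gcd_dvd_right (d a) (aFirst hp a)))
  rw [← Int.natCast_dvd_natCast]
  simpa [headDiff] using h2

theorem BoundedRep.d_dvd {hp : 3 ≤ p} {a : Fin p → ℕ} (ha : StrictMono a) {n h : ℤ}
    (H : BoundedRep (inner p) (headDiff hp a) (totalDiff hp a) n h) : (d a : ℤ) ∣ h := by
  obtain ⟨y, j, k, -, -, -, -, rfl⟩ := H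
  exact dvd_add (Finset.dvd_sum fun i _ => (d_dvd_headDiff hp ha i).mul_left _)
    ((d_dvd_headDiff hp ha ⟨p - 1, by omega⟩).mul_left _)

theorem d_dvd_sub_of_mem_nu (hp : 3 ≤ p) {a : Fin p → ℕ} (ha : StrictMono a)
    (hgcd : Finset.univ.gcd a = 1) {n m : ℕ} (hm : m ∈ nu a n) : (d a : ℤ) ∣ (m : ℤ) - n := by
  obtain ⟨s, h1, h2⟩ := (mem_nu_iff hp a n m).1 hm
  refine (isCoprime_d_aFirst hp ha hgcd).dvd_of_dvd_mul_right ?_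
  have := dvd_sub (h1.d_dvd ha) (h2.d_dvd ha)
  convert this using 1
  ring

end Divisibility

theorem headDiff_nonneg (hp : 3 ≤ p) {a : Fin p → ℕ} (ha : StrictMono a) (i : Fin p) :
    0 ≤ headDiff hp a i := by
  have : aFirst hp a ≤ a i := ha.monotone (Fin.mk_le_of_le_val (Nat.zero_le _))
  simp only [headDiff]
  omega

theorem headDiff_le_totalDiff (hp : 3 ≤ p) {a : Fin p → ℕ} (ha : StrictMono a) (i : Fin p) :
    headDiff hp a i ≤ totalDiff hp a := by
  have : a i ≤ aLast hp a := ha.monotone (Fin.le_def.2 (by simp; omega))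
  simp only [headDiff, totalDiff]
  omega

theorem totalDiff_pos (hp : 3 ≤ p) {a : Fin p → ℕ} (ha : StrictMono a) : 0 < totalDiff hp a := by
  have : aFirst hp a < aLast hp a := ha (Fin.lt_def.2 (by simp; omega))
  simp only [totalDiff]
  omega

theorem tripleGcd_dvd_headDiff (hp : 3 ≤ p) (a : Fin p → ℕ) (i : Fin p) :
    (tripleGcd hp a i : ℤ) ∣ headDiff hp a i := Int.gcd_dvd_left ..

theorem tripleGcd_dvd_totalDiff (hp : 3 ≤ p) (a : Fin p → ℕ) (i : Fin p) :
    (tripleGcd hp a i : ℤ) ∣ totalDiff hp a := by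
  have h1 : (tripleGcd hp a i : ℤ) ∣ (aFirst hp a : ℤ) - aLast hp a :=
    (Int.gcd_dvd_right ..).trans (Int.gcd_dvd_left ..)
  simpa [totalDiff] using h1.neg_right

theorem tripleGcd_pos (hp : 3 ≤ p) {a : Fin p → ℕ} (ha : StrictMono a) (i : Fin p) :
    (0 : ℤ) < tripleGcd hp a i := by
  have h := tripleGcd_dvd_totalDiff hp a i
  have := (totalDiff_pos hp ha).ne'
  rcases Nat.eq_zero_or_pos (tripleGcd hp a i) with h0 | h0
  · rw [h0] at h
    exact absurd (by simpa using h) this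
  · exact_mod_cast h0

theorem d_pos (hp : 3 ≤ p) {a : Fin p → ℕ} (ha : StrictMono a) : 0 < d a := by
  have h : (d a : ℤ) ∣ totalDiff hp a := d_dvd_headDiff hp ha ⟨p - 1, by omega⟩
  rcases Nat.eq_zero_or_pos (d a) with h0 | h0
  · rw [h0] at h
    exact absurd (by simpa using h) (totalDiff_pos hp ha).ne'
  · exact h0

/-- `∑ (a_i - a₁) (a_p - a₁) / g_i`. -/
def headBound (hp : 3 ≤ p) (a : Fin p → ℕ) : ℤ :=
  reducedBound (inner p) (headDiff hp a) (fun i => tripleGcd hp a i) (totalDiff hp a)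

/-- `∑ (a_p - a_i) (a_p - a₁) / g_i`. -/
def tailBound (hp : 3 ≤ p) (a : Fin p → ℕ) : ℤ :=
  reducedBound (inner p) (fun i => totalDiff hp a - headDiff hp a i)
    (fun i => tripleGcd hp a i) (totalDiff hp a)

theorem headBound_nonneg (hp : 3 ≤ p) {a : Fin p → ℕ} (ha : StrictMono a) :
    0 ≤ headBound hp a :=
  reducedBound_nonneg (totalDiff_pos hp ha) (fun i _ => tripleGcd_pos hp ha i)
    fun i _ => headDiff_nonneg hp ha i

theorem tailBound_nonneg (hp : 3 ≤ p) {a : Fin p → ℕ} (ha : StrictMono a) :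
    0 ≤ tailBound hp a :=
  reducedBound_nonneg (totalDiff_pos hp ha) (fun i _ => tripleGcd_pos hp ha i)
    fun i _ => sub_nonneg.2 (headDiff_le_totalDiff hp ha i)

/-! ### Comparison of `E` and `F` with the constants of the statement. -/

section Constants

theorem aFirst_lt_aSecond (hp : 3 ≤ p) {a : Fin p → ℕ} (ha : StrictMono a) :
    aFirst hp a < aSecond hp a := ha (Fin.lt_def.2 (by simp))

theorem aPenult_lt_aLast (hp : 3 ≤ p) {a : Fin p → ℕ} (ha : StrictMono a) :
    aPenult hp a < aLast hp a := ha (Fin.lt_def.2 (by simp; omega))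

theorem le_NS (hp : 3 ≤ p) (a : Fin p → ℕ) {i : Fin p} (hi : i ∈ inner p) :
    Sval hp a i ≤ NS hp a ∧ Sval' hp a i ≤ NS hp a := by
  have h := (Finset.le_sup' (fun i => max (Sval hp a i) (Sval' hp a i)) hi).trans (Int.le_ceil _)
  exact ⟨(le_max_left _ _).trans h, (le_max_right _ _).trans h⟩

/-- Averaging over the `p - 2` inner indices; this explains the factor `p - 2` in `S_i` and `S'_i`,
whose maximum thereby controls a whole sum. -/
theorem le_of_card_mul_le {c X : ℚ} (hp : 3 ≤ p) {f : Fin p → ℚ}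
    (h : ∀ i ∈ inner p, c + ((p : ℚ) - 2) * f i ≤ X) : c + ∑ i ∈ inner p, f i ≤ X := by
  have h1 := Finset.sum_le_sum h
  have hc : ((inner p).card : ℚ) = (p : ℚ) - 2 := by
    rw [card_inner hp, Nat.cast_sub (by omega)]; norm_num
  rw [Finset.sum_add_distrib, ← Finset.mul_sum, Finset.sum_const, Finset.sum_const, nsmul_eq_mul,
    nsmul_eq_mul, hc, ← mul_add] at h1
  have hp' : (3 : ℚ) ≤ p := by exact_mod_cast hp
  exact le_of_mul_le_mul_left h1 (by linarith)

theorem cast_tripleGcd_quotient (hp : 3 ≤ p) {a : Fin p → ℕ} (ha : StrictMono a) (i : Fin p) :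
    ((totalDiff hp a / (tripleGcd hp a i : ℤ) : ℤ) : ℚ) =
      ((aLast hp a : ℚ) - aFirst hp a) / tripleGcd hp a i := by
  have h0 : ((tripleGcd hp a i : ℤ) : ℚ) ≠ 0 := by exact_mod_cast (tripleGcd_pos hp ha i).ne'
  rw [Int.cast_div (tripleGcd_dvd_totalDiff hp a i) h0]
  simp [totalDiff]

theorem headBound_le_neg_C2 (hp : 3 ≤ p) {a : Fin p → ℕ} (ha_pos : ∀ i, 0 < a i)
    (ha : StrictMono a) :
    (aFirst hp a : ℚ) * d a + headBound hp a ≤ -C2 hp a := by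
  have h2 : (0 : ℚ) < aSecond hp a := by exact_mod_cast ha_pos _
  have h12 : (aFirst hp a : ℚ) < aSecond hp a := by exact_mod_cast aFirst_lt_aSecond hp ha
  simp only [headBound, reducedBound]
  push_cast
  refine le_of_card_mul_le hp fun i hi => ?_
  have hg : (0 : ℚ) < tripleGcd hp a i := by exact_mod_cast tripleGcd_pos hp ha i
  have h := (le_NS hp a hi).1
  rw [cast_tripleGcd_quotient hp ha]
  -- `S_i` is designed so that, scaled by `(a₂ - a₁) / a₂`, it becomes `a₁ d` plus `p - 2` times the
  -- `i`-th term of `E`; the same scaling of `N_S` gives `-C₂`.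
  have hS : Sval hp a i * ((aSecond hp a - aFirst hp a) / aSecond hp a) =
      (aFirst hp a : ℚ) * d a + ((p : ℚ) - 2) *
        (((aLast hp a : ℚ) - aFirst hp a) / tripleGcd hp a i * headDiff hp a i) := by
    have h3 : (aFirst hp a : ℚ) - aSecond hp a ≠ 0 := by linarith
    simp only [Sval, headDiff]
    push_cast
    field_simp
    ring
  rw [← hS]
  calc _ ≤ (NS hp a : ℚ) * ((aSecond hp a - aFirst hp a) / aSecond hp a) :=
        mul_le_mul_of_nonneg_right h (div_nonneg (by linarith) h2.le)
    _ = -C2 hp a := by simp only [C2]; ring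

theorem tailBound_le_C1 (hp : 3 ≤ p) {a : Fin p → ℕ} (ha_pos : ∀ i, 0 < a i)
    (ha : StrictMono a) :
    (aLast hp a : ℚ) * d a + tailBound hp a ≤ C1 hp a := by
  have h2 : (0 : ℚ) < aPenult hp a := by exact_mod_cast ha_pos _
  have h12 : (aPenult hp a : ℚ) < aLast hp a := by exact_mod_cast aPenult_lt_aLast hp ha
  simp only [tailBound, reducedBound]
  push_cast
  refine le_of_card_mul_le hp fun i hi => ?_
  have hg : (0 : ℚ) < tripleGcd hp a i := by exact_mod_cast tripleGcd_pos hp ha i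
  have h := (le_NS hp a hi).2
  rw [cast_tripleGcd_quotient hp ha]
  -- The mirror identity: scaling by `(a_p - a_{p-1}) / a_{p-1}` produces the `i`-th term of `F`,
  -- and turns `N_S` into `C₁`.
  have hS : Sval' hp a i * ((aLast hp a - aPenult hp a) / aPenult hp a) =
      (aLast hp a : ℚ) * d a + ((p : ℚ) - 2) *
        (((aLast hp a : ℚ) - aFirst hp a) / tripleGcd hp a i *
          (totalDiff hp a - headDiff hp a i)) := by
    have h3 : (aPenult hp a : ℚ) - aLast hp a ≠ 0 := by linarith
    simp only [Sval', headDiff, totalDiff]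
    push_cast
    field_simp
    ring
  rw [← hS]
  calc _ ≤ (NS hp a : ℚ) * ((aLast hp a - aPenult hp a) / aPenult hp a) :=
        mul_le_mul_of_nonneg_right h (div_nonneg (by linarith) h2.le)
    _ = C1 hp a := by simp only [C1]; ring

theorem le_mul_lambda2 (hp : 3 ≤ p) {a : Fin p → ℕ} (ha_pos : ∀ i, 0 < a i) :
    (aLast hp a : ℚ) * -C2 hp a + aFirst hp a * C1 hp a ≤ aFirst hp a * lambda2 hp a := by
  have h1 : (0 : ℚ) < aFirst hp a := by exact_mod_cast ha_pos _
  have h2 : (0 : ℚ) < aSecond hp a := by exact_mod_cast ha_pos _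
  have h3 : (0 : ℚ) < aPenult hp a := by exact_mod_cast ha_pos _
  have h : -C3 hp a ≤ lambda2 hp a := neg_le_neg (min_le_right _ _)
  -- `C₃` is a disguised combination of the other two: `-C₃ = (a_p / a₁)(-C₂) + C₁`.
  have h4 : (aLast hp a : ℚ) * -C2 hp a + aFirst hp a * C1 hp a = aFirst hp a * -C3 hp a := by
    simp only [C1, C2, C3]
    field_simp
    ring
  rw [h4]
  exact mul_le_mul_of_nonneg_left h h1.le

theorem neg_C2_le_lambda1 (hp : 3 ≤ p) {a : Fin p → ℕ} (ha_pos : ∀ i, 0 < a i)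
    (hC1 : 0 ≤ C1 hp a) : -C2 hp a ≤ lambda1 hp a := by
  have h1 : (0 : ℚ) < aFirst hp a := by exact_mod_cast ha_pos _
  have h2 : (0 : ℚ) < aSecond hp a := by exact_mod_cast ha_pos _
  have h3 : (0 : ℚ) < aPenult hp a := by exact_mod_cast ha_pos _
  have h5 : (0 : ℚ) < aLast hp a := by exact_mod_cast ha_pos _
  refine le_trans ?_ (le_max_right _ _)
  have h4 : C4 hp a = -C2 hp a + aFirst hp a / aLast hp a * C1 hp a := by
    simp only [C1, C2, C4]
    field_simp
    ring
  rw [h4]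
  have : 0 ≤ (aFirst hp a : ℚ) / aLast hp a * C1 hp a := by positivity
  linarith

end Constants

/-! ### Criteria for membership in `ν(n)`. -/

section Nu

theorem BoundedRep.add_first {ι : Type*} {I : Finset ι} {e : ι → ℤ} {D n h : ℤ}
    (H : BoundedRep I e D n h) {k : ℤ} (hk : 0 ≤ k) : BoundedRep I e D (n + k) h := by
  obtain ⟨y, j, l, hy, hj, hl, hn, hh⟩ := H
  exact ⟨y, j + k, l, hy, by linarith, hl, by linarith, hh⟩

theorem BoundedRep.add_last {ι : Type*} {I : Finset ι} {e : ι → ℤ} {D n h : ℤ}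
    (H : BoundedRep I e D n h) {k : ℤ} (hk : 0 ≤ k) : BoundedRep I e D (n + k) (h + k * D) := by
  obtain ⟨y, j, l, hy, hj, hl, hn, hh⟩ := H
  exact ⟨y, j, l + k, hy, hj, by linarith, by linarith, by rw [← hh]; ring⟩

theorem mem_nu_comm (hp : 3 ≤ p) {a : Fin p → ℕ} {n m : ℕ} : m ∈ nu a n ↔ n ∈ nu a m := by
  simp only [mem_nu_iff hp, and_comm]

/-- Add `μ a₁` copies of `a_p` to one factorization and `μ a_p` copies of `a₁` to the other: both
sums grow by `μ a₁ a_p`. No lower bound on `n` is needed in this direction. -/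
theorem add_mem_nu (hp : 3 ≤ p) {a : Fin p → ℕ} {n m : ℕ} (h : m ∈ nu a n) (μ : ℕ) :
    m + μ * aLast hp a ∈ nu a (n + μ * aFirst hp a) := by
  obtain ⟨s, h1, h2⟩ := (mem_nu_iff hp a n m).1 h
  refine (mem_nu_iff hp a _ _).2 ⟨s + μ * aFirst hp a * aLast hp a, ?_, ?_⟩
  · convert h1.add_last (k := μ * aFirst hp a) (by positivity) using 1
    · push_cast; ring
    · push_cast [totalDiff]; ring
  · convert h2.add_first (k := μ * aLast hp a) (by positivity) using 1
    · push_cast; ring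
    · push_cast; ring

theorem d_dvd_headBound (hp : 3 ≤ p) {a : Fin p → ℕ} (ha : StrictMono a) :
    (d a : ℤ) ∣ headBound hp a := by
  rw [headBound, reducedBound]
  exact Finset.dvd_sum fun i _ => (d_dvd_headDiff hp ha i).mul_left _

theorem boundedRep_of_dvd (hp : 3 ≤ p) {a : Fin p → ℕ} (ha : StrictMono a) {n h : ℤ}
    (hd : (d a : ℤ) ∣ h) (hh : headBound hp a ≤ h)
    (hn : h + tailBound hp a ≤ n * totalDiff hp a) :
    BoundedRep (inner p) (headDiff hp a) (totalDiff hp a) n h :=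
  boundedRep_of_mem_middle (totalDiff_pos hp ha) (fun i _ => tripleGcd_pos hp ha i)
    (fun i _ => tripleGcd_dvd_totalDiff hp a i) (fun i _ => tripleGcd_dvd_headDiff hp a i)
    (fun i _ => headDiff_nonneg hp ha i) (fun i _ => headDiff_le_totalDiff hp ha i)
    (exists_combination hp ha hd) hh hn

theorem mem_nu_of_le (hp : 3 ≤ p) {a : Fin p → ℕ} (ha : StrictMono a) {n m : ℕ} (hnm : n ≤ m)
    (hd : (d a : ℤ) ∣ (m : ℤ) - n)
    (h : (m : ℤ) * aFirst hp a + headBound hp a + tailBound hp a ≤ n * aLast hp a) :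
    m ∈ nu a n := by
  have hnm' : (0 : ℤ) ≤ (m : ℤ) - n := by omega
  have h1 : 0 ≤ ((m : ℤ) - n) * aFirst hp a := by positivity
  have h2 : 0 ≤ ((m : ℤ) - n) * aLast hp a := by positivity
  -- The least `s` for which `s - m a₁` has entered the gap-free range of the `m`-sums.
  refine (mem_nu_iff hp a n m).2 ⟨m * aFirst hp a + headBound hp a, ?_, ?_⟩
  · refine boundedRep_of_dvd hp ha ?_ (by linarith) (by rw [totalDiff]; linarith)
    rw [show (m : ℤ) * aFirst hp a + headBound hp a - n * aFirst hp a =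
      headBound hp a + ((m : ℤ) - n) * aFirst hp a by ring]
    exact dvd_add (d_dvd_headBound hp ha) (hd.mul_right _)
  · rw [add_sub_cancel_left]
    exact boundedRep_of_dvd hp ha (d_dvd_headBound hp ha) le_rfl (by rw [totalDiff]; linarith)

/-- Taking `s = m a_p`, the factorization of length `m` is `m` copies of `a_p`, so only the `n`-sums
have to be in their gap-free range. The separation required is then smaller than in `mem_nu_of_le`.
-/
theorem mem_nu_of_mul_aLast (hp : 3 ≤ p) {a : Fin p → ℕ} (ha : StrictMono a) {n m : ℕ}
    (hd : (d a : ℤ) ∣ (m : ℤ) - n)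
    (h1 : (n : ℤ) * aFirst hp a + headBound hp a ≤ m * aLast hp a)
    (h2 : (m : ℤ) * aLast hp a + tailBound hp a ≤ n * aLast hp a) : m ∈ nu a n := by
  refine (mem_nu_iff hp a n m).2 ⟨m * aLast hp a, ?_, ?_⟩
  · refine boundedRep_of_dvd hp ha ?_ (by linarith) (by rw [totalDiff]; linarith)
    have hD : (d a : ℤ) ∣ totalDiff hp a := d_dvd_headDiff hp ha ⟨p - 1, by omega⟩
    rw [show (m : ℤ) * aLast hp a - n * aFirst hp a =
      m * totalDiff hp a + ((m : ℤ) - n) * aFirst hp a by rw [totalDiff]; ring]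
    exact dvd_add (hD.mul_left _) (hd.mul_right _)
  · exact ⟨0, 0, m, by simp, le_rfl, by positivity, by simp, by
      simp only [Pi.zero_apply, zero_mul, Finset.sum_const_zero, totalDiff]; ring⟩

theorem mul_aFirst_le_of_mem_nu (hp : 3 ≤ p) {a : Fin p → ℕ} (ha : StrictMono a) {n m : ℕ}
    (h : m ∈ nu a n) : n * aFirst hp a ≤ m * aLast hp a := by
  obtain ⟨s, h1, h2⟩ := (mem_nu_iff hp a n m).1 h
  have h3 := h1.nonneg (fun i _ => headDiff_nonneg hp ha i) (totalDiff_pos hp ha).le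
  have h4 := h2.reflect.nonneg (fun i _ => sub_nonneg.2 (headDiff_le_totalDiff hp ha i))
    (totalDiff_pos hp ha).le
  rw [totalDiff] at h4
  zify
  linarith

/-- Near the ends of their ranges, the sums of `n` and of `m` terms have the same common elements
as the sums of `n'` and `m'` terms. -/
theorem mem_nu_of_mem_nu (hp : 3 ≤ p) {a : Fin p → ℕ} (ha : StrictMono a) {n m n' m' : ℕ}
    (h : m ∈ nu a n)
    (heq : (n : ℤ) * aLast hp a - m * aFirst hp a = n' * aLast hp a - m' * aFirst hp a)
    (hn : (n' : ℤ) * aLast hp a - m' * aFirst hp a + headBound hp a ≤ n' * totalDiff hp a)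
    (hm : (n' : ℤ) * aLast hp a - m' * aFirst hp a + tailBound hp a ≤ m' * totalDiff hp a) :
    m' ∈ nu a n' := by
  obtain ⟨s, h1, h2⟩ := (mem_nu_iff hp a n m).1 h
  have hh := h2.nonneg (fun i _ => headDiff_nonneg hp ha i) (totalDiff_pos hp ha).le
  have hge := h1.reflect.nonneg (fun i _ => sub_nonneg.2 (headDiff_le_totalDiff hp ha i))
    (totalDiff_pos hp ha).le
  have e1 : (n : ℤ) * totalDiff hp a = n * aLast hp a - n * aFirst hp a := by rw [totalDiff]; ring
  have e2 : (n' : ℤ) * totalDiff hp a = n' * aLast hp a - n' * aFirst hp a := by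
    rw [totalDiff]; ring
  -- The new `s` keeps its distance to the bottom `m a₁` of the range for `m`; by `heq` it also
  -- keeps its distance to the top `n a_p` of the range for `n`.
  refine (mem_nu_iff hp a n' m').2 ⟨s - m * aFirst hp a + m' * aFirst hp a, ?_, ?_⟩
  · have h3 : s - n * aFirst hp a = n * totalDiff hp a - (n * aLast hp a - s) := by
      rw [totalDiff]; ring
    rw [h3] at h1
    have h4 := h1.change_tail (n' := n') (totalDiff_pos hp ha) (fun i _ => tripleGcd_pos hp ha i)
      (fun i _ => tripleGcd_dvd_totalDiff hp a i) (fun i _ => tripleGcd_dvd_headDiff hp a i)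
      (fun i _ => headDiff_nonneg hp ha i) (fun i _ => headDiff_le_totalDiff hp ha i)
      (show _ + headBound hp a ≤ _ by linarith)
    convert h4 using 1
    linarith
  · rw [add_sub_cancel_right]
    exact h2.change_head (totalDiff_pos hp ha) (fun i _ => tripleGcd_pos hp ha i)
      (fun i _ => tripleGcd_dvd_totalDiff hp a i) (fun i _ => tripleGcd_dvd_headDiff hp a i)
      (fun i _ => headDiff_nonneg hp ha i) (fun i _ => headDiff_le_totalDiff hp ha i)
      (show _ + tailBound hp a ≤ _ by linarith)

end Nu

/-! ### Description of the three zones. -/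

section Zones

variable {a : Fin p → ℕ} {n : ℕ}

/-- The inequalities between the constants on which the description of the zones depends. -/
theorem zone_bounds (hp : 3 ≤ p) (ha_pos : ∀ i, 0 < a i) (ha : StrictMono a)
    (hn : N0 hp a ≤ (n : ℚ)) :
    (headBound hp a : ℚ) + aFirst hp a * d a ≤ lambda1 hp a ∧
    (tailBound hp a : ℚ) ≤ lambda1 hp a ∧
    (headBound hp a : ℚ) + tailBound hp a ≤ lambda2 hp a ∧
    (aLast hp a : ℚ) * headBound hp a ≤ aFirst hp a * lambda2 hp a ∧
    (aLast hp a : ℚ) - aFirst hp a + lambda1 hp a + lambda2 hp a ≤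
      n * ((aLast hp a : ℚ) - aFirst hp a) := by
  have hP := headBound_le_neg_C2 hp ha_pos ha
  have hQ := tailBound_le_C1 hp ha_pos ha
  have hE : (0 : ℚ) ≤ headBound hp a := by exact_mod_cast headBound_nonneg hp ha
  have hF : (0 : ℚ) ≤ tailBound hp a := by exact_mod_cast tailBound_nonneg hp ha
  have h1 : (0 : ℚ) < aFirst hp a := by exact_mod_cast ha_pos _
  have hD : (0 : ℚ) < (aLast hp a : ℚ) - aFirst hp a := by
    have := totalDiff_pos hp ha
    rw [totalDiff] at this
    exact_mod_cast this
  have h1d : 0 ≤ (aFirst hp a : ℚ) * d a := by positivity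
  have hpd : 0 ≤ (aLast hp a : ℚ) * d a := by positivity
  have hl2 := le_mul_lambda2 hp ha_pos
  have hE' : (headBound hp a : ℚ) ≤ -C2 hp a := by linarith
  have hF' : (tailBound hp a : ℚ) ≤ C1 hp a := by linarith
  have hE1 : (aLast hp a : ℚ) * headBound hp a ≤ aLast hp a * -C2 hp a :=
    mul_le_mul_of_nonneg_left hE' (by linarith)
  have hF1 : (aFirst hp a : ℚ) * tailBound hp a ≤ aFirst hp a * C1 hp a :=
    mul_le_mul_of_nonneg_left hF' h1.le
  have hF0 : 0 ≤ (aFirst hp a : ℚ) * tailBound hp a := by positivity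
  have hDE := mul_nonneg hD.le hE
  refine ⟨?_, hF'.trans (le_max_left _ _), ?_, by linarith, ?_⟩
  · linarith [neg_C2_le_lambda1 hp ha_pos (hF.trans hF')]
  -- After multiplication by `a₁`: `a₁ (E + F) ≤ a_p E + a₁ F ≤ a_p (-C₂) + a₁ C₁ ≤ a₁ λ₂`.
  · exact le_of_mul_le_mul_left (a := (aFirst hp a : ℚ)) (by linarith) h1
  · exact (div_le_iff₀ hD).1 ((le_max_right _ _).trans hn)

theorem mem_B1_iff (hp : 3 ≤ p) (ha_pos : ∀ i, 0 < a i) {x : ℕ} :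
    x ∈ B1 hp a n ↔ x ∈ nu a n ∧
      (n : ℚ) * aLast hp a - x * aFirst hp a < lambda2 hp a := by
  have h1 : (0 : ℚ) < aFirst hp a := by exact_mod_cast ha_pos _
  simp only [B1, Set.mem_ofPred_eq, div_lt_iff₀ h1, sub_lt_comm]

theorem mem_B3_iff (hp : 3 ≤ p) (ha_pos : ∀ i, 0 < a i) {x : ℕ} :
    x ∈ B3 hp a n ↔ x ∈ nu a n ∧
      (x : ℚ) * aLast hp a - n * aFirst hp a < lambda1 hp a := by
  have h1 : (0 : ℚ) < aLast hp a := by exact_mod_cast ha_pos _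
  simp only [B3, Set.mem_ofPred_eq, lt_div_iff₀ h1, sub_lt_iff_lt_add']

theorem mem_B2_iff (hp : 3 ≤ p) (ha_pos : ∀ i, 0 < a i) (ha : StrictMono a)
    (hgcd : Finset.univ.gcd a = 1) (hn : N0 hp a ≤ (n : ℚ)) {x : ℕ} :
    x ∈ B2 hp a n ↔ (d a : ℤ) ∣ (x : ℤ) - n ∧
      lambda2 hp a ≤ (n : ℚ) * aLast hp a - x * aFirst hp a ∧
      lambda1 hp a ≤ (x : ℚ) * aLast hp a - n * aFirst hp a := by
  obtain ⟨hP, hQ, hPQ, -, hnD⟩ := zone_bounds hp ha_pos ha hn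
  simp only [B2, Set.mem_sdiff, Set.mem_union, mem_B1_iff hp ha_pos, mem_B3_iff hp ha_pos]
  constructor
  · rintro ⟨h, h'⟩
    refine ⟨d_dvd_sub_of_mem_nu hp ha hgcd h, ?_, ?_⟩ <;> by_contra! h1
    · exact h' (Or.inl ⟨h, h1⟩)
    · exact h' (Or.inr ⟨h, h1⟩)
  · rintro ⟨hd, h2, h1⟩
    refine ⟨?_, fun h => h.elim (fun h => h.2.not_ge h2) fun h => h.2.not_ge h1⟩
    rcases le_total n x with hnx | hnx
    · refine mem_nu_of_le hp ha hnx hd ?_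
      have : (x : ℚ) * aFirst hp a + headBound hp a + tailBound hp a ≤ n * aLast hp a := by linarith
      exact_mod_cast this
    · have h1d : 0 ≤ (aFirst hp a : ℚ) * d a := by positivity
      -- `zone_bounds` bounds `E` and `F` separately by `λ₁`, not their sum, so `mem_nu_of_le` with
      -- `n` and `x` exchanged may fail for small `x`. There `s = x a_p` works; otherwise `x a_p > n
      -- a_p - F`, and `nD ≥ λ₁ + λ₂` leaves room for `E + F`.
      by_cases hF : (x : ℤ) * aLast hp a + tailBound hp a ≤ n * aLast hp a
      · refine mem_nu_of_mul_aLast hp ha hd ?_ hF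
        have : (n : ℚ) * aFirst hp a + headBound hp a ≤ x * aLast hp a := by linarith
        exact_mod_cast this
      · have hF' : (n : ℚ) * aLast hp a < x * aLast hp a + tailBound hp a := by
          exact_mod_cast not_le.1 hF
        rw [mem_nu_comm hp]
        refine mem_nu_of_le hp ha hnx (by rw [← dvd_neg, neg_sub]; exact hd) ?_
        have h3 : (aFirst hp a : ℚ) ≤ aLast hp a := by
          exact_mod_cast (ha.monotone (Fin.mk_le_of_le_val (Nat.zero_le _)) :
            aFirst hp a ≤ aLast hp a)
        have : (n : ℚ) * aFirst hp a + headBound hp a + tailBound hp a ≤ x * aLast hp a := by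
          linarith
        exact_mod_cast this

theorem delta_B2 (hp : 3 ≤ p) (ha_pos : ∀ i, 0 < a i) (ha : StrictMono a)
    (hgcd : Finset.univ.gcd a = 1) (hn : N0 hp a ≤ (n : ℚ)) :
    delta (B2 hp a n) = {d a} := by
  obtain ⟨hP, hQ, hPQ, -, hnD⟩ := zone_bounds hp ha_pos ha hn
  have hd := d_pos hp ha
  have h1 : (0 : ℚ) ≤ aFirst hp a := by positivity
  have h2 : (0 : ℚ) ≤ aLast hp a := by positivity
  have hE : (0 : ℚ) ≤ headBound hp a := by exact_mod_cast headBound_nonneg hp ha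
  have hF : (0 : ℚ) ≤ tailBound hp a := by exact_mod_cast tailBound_nonneg hp ha
  have hD : (0 : ℚ) < (aLast hp a : ℚ) - aFirst hp a := by
    have := totalDiff_pos hp ha
    rw [totalDiff] at this
    exact_mod_cast this
  have h1d : 0 ≤ (aFirst hp a : ℚ) * d a := by positivity
  have hpd : 0 ≤ (aLast hp a : ℚ) * d a := by positivity
  ext k
  rw [Set.mem_singleton_iff]
  constructor
  · rintro ⟨l, hl, m, hm, hlm, hz, rfl⟩
    obtain ⟨hld, hl2, hl1⟩ := (mem_B2_iff hp ha_pos ha hgcd hn).1 hl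
    obtain ⟨hmd, hm2, hm1⟩ := (mem_B2_iff hp ha_pos ha hgcd hn).1 hm
    have hdvd : (d a : ℤ) ∣ (m : ℤ) - l := by simpa using dvd_sub hmd hld
    have hle : (d a : ℤ) ≤ (m : ℤ) - l := Int.le_of_dvd (by omega) hdvd
    by_contra hne
    refine hz (l + d a) ((mem_B2_iff hp ha_pos ha hgcd hn).2 ⟨?_, ?_, ?_⟩) ⟨by omega, by omega⟩
    · rw [Nat.cast_add, add_sub_right_comm]
      exact dvd_add hld dvd_rfl
    · have h3 : ((l + d a : ℕ) : ℚ) ≤ m := by exact_mod_cast (by omega : l + d a ≤ m)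
      linarith [mul_le_mul_of_nonneg_right h3 h1]
    · push_cast
      linarith
  · rintro rfl
    -- The zone contains `n` and `n + d`, so `Δ` is nonempty. For `n + d` the needed slack `a₁ d`
    -- comes from the first inequality of `zone_bounds`.
    refine ⟨n, (mem_B2_iff hp ha_pos ha hgcd hn).2 ⟨by simp, by linarith, by linarith⟩, n + d a,
      (mem_B2_iff hp ha_pos ha hgcd hn).2 ⟨by simp, ?_, ?_⟩, by omega, ?_, by omega⟩
    · push_cast
      linarith
    · push_cast
      linarith
    · rintro z hz ⟨hz1, hz2⟩
      have := Int.le_of_dvd (by omega) ((mem_B2_iff hp ha_pos ha hgcd hn).1 hz).1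
      omega

theorem B1_add (hp : 3 ≤ p) (ha_pos : ∀ i, 0 < a i) (ha : StrictMono a)
    (hn : N0 hp a ≤ (n : ℚ)) (μ : ℕ) :
    B1 hp a (n + μ * aFirst hp a) = (· + μ * aLast hp a) '' B1 hp a n := by
  obtain ⟨hP, hQ, hPQ, -, hnD⟩ := zone_bounds hp ha_pos ha hn
  have h1 : (0 : ℚ) < aFirst hp a := by exact_mod_cast ha_pos _
  have hE : (0 : ℚ) ≤ headBound hp a := by exact_mod_cast headBound_nonneg hp ha
  have hF : (0 : ℚ) ≤ tailBound hp a := by exact_mod_cast tailBound_nonneg hp ha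
  have h1d : 0 ≤ (aFirst hp a : ℚ) * d a := by positivity
  have hD : (0 : ℚ) < (aLast hp a : ℚ) - aFirst hp a := by
    have := totalDiff_pos hp ha
    rw [totalDiff] at this
    exact_mod_cast this
  ext x
  rw [mem_B1_iff hp ha_pos]
  constructor
  · rintro ⟨hx, hlt⟩
    push_cast at hlt
    -- A length in the first zone, translated back by `μ a_p`, still exceeds `n`, because `λ₂ ≤ nD`.
    -- So the subtraction is legitimate, and both size conditions of `mem_nu_of_mem_nu` follow from
    -- `λ₁ + λ₂ ≤ nD ≤ mD`.
    have hnx : (n : ℚ) + μ * aLast hp a < x :=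
      lt_of_mul_lt_mul_right (a := (aFirst hp a : ℚ)) (by linarith) h1.le
    have hnx' : n + μ * aLast hp a < x := by exact_mod_cast hnx
    obtain ⟨m, rfl⟩ := Nat.exists_eq_add_of_le' (by omega : μ * aLast hp a ≤ x)
    have hnm : (n : ℚ) ≤ m := by exact_mod_cast (by omega : n ≤ m)
    have hmD := mul_le_mul_of_nonneg_right hnm hD.le
    push_cast at hlt
    refine ⟨m, (mem_B1_iff hp ha_pos).2 ⟨mem_nu_of_mem_nu hp ha hx ?_ ?_ ?_, by linarith⟩, rfl⟩
    · push_cast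
      ring
    · have : (n : ℚ) * aLast hp a - m * aFirst hp a + headBound hp a ≤
          n * ((aLast hp a : ℚ) - aFirst hp a) := by linarith
      rw [totalDiff]
      exact_mod_cast this
    · have : (n : ℚ) * aLast hp a - m * aFirst hp a + tailBound hp a ≤
          m * ((aLast hp a : ℚ) - aFirst hp a) := by linarith
      rw [totalDiff]
      exact_mod_cast this
  · rintro ⟨m, hm, rfl⟩
    obtain ⟨hm, hlt⟩ := (mem_B1_iff hp ha_pos).1 hm
    refine ⟨add_mem_nu hp hm μ, ?_⟩
    push_cast
    linarith

theorem B3_add (hp : 3 ≤ p) (ha_pos : ∀ i, 0 < a i) (ha : StrictMono a)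
    (hn : N0 hp a ≤ (n : ℚ)) (μ : ℕ) :
    B3 hp a (n + μ * aLast hp a) = (· + μ * aFirst hp a) '' B3 hp a n := by
  obtain ⟨hP, hQ, hPQ, hPa, hnD⟩ := zone_bounds hp ha_pos ha hn
  have h1 : (0 : ℚ) < aFirst hp a := by exact_mod_cast ha_pos _
  have h2 : (0 : ℚ) < aLast hp a := by exact_mod_cast ha_pos _
  have hE : (0 : ℚ) ≤ headBound hp a := by exact_mod_cast headBound_nonneg hp ha
  have hF : (0 : ℚ) ≤ tailBound hp a := by exact_mod_cast tailBound_nonneg hp ha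
  have h1d : 0 ≤ (aFirst hp a : ℚ) * d a := by positivity
  have hD : (0 : ℚ) < (aLast hp a : ℚ) - aFirst hp a := by
    have := totalDiff_pos hp ha
    rw [totalDiff] at this
    exact_mod_cast this
  ext x
  rw [mem_B3_iff hp ha_pos]
  constructor
  · rintro ⟨hx, hlt⟩
    have hge := mul_aFirst_le_of_mem_nu hp ha hx
    have hx' : μ * aFirst hp a ≤ x :=
      Nat.le_of_mul_le_mul_right (c := aLast hp a) (by linarith [Nat.zero_le (n * aFirst hp a)])
        (ha_pos _)
    obtain ⟨m, rfl⟩ := Nat.exists_eq_add_of_le' hx'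
    have hge' : (n : ℚ) * aFirst hp a ≤ m * aLast hp a := by
      exact_mod_cast (by linarith : n * aFirst hp a ≤ m * aLast hp a)
    push_cast at hlt
    have hlt' : (m : ℚ) * aLast hp a - n * aFirst hp a < lambda1 hp a := by linarith
    refine ⟨m, (mem_B3_iff hp ha_pos).2 ⟨?_, hlt'⟩, rfl⟩
    -- With the two lengths exchanged, the third zone becomes the situation of the first one, `m`
    -- now being the shorter length.
    rw [mem_nu_comm hp] at hx ⊢
    refine mem_nu_of_mem_nu hp ha hx (by push_cast; ring) ?_ ?_
    · have : (m : ℚ) * aLast hp a - n * aFirst hp a + headBound hp a ≤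
          m * ((aLast hp a : ℚ) - aFirst hp a) := by
        -- Here `m` is only about `n a₁ / a_p`. The claim amounts to `E + m a₁ ≤ n a₁`; multiplied
        -- by `a_p` and using `m a_p < n a₁ + λ₁`, it reduces to `a_p E + a₁ λ₁ ≤ a₁ n D`, whence
        -- the need for `a_p E ≤ a₁ λ₂`.
        refine le_of_mul_le_mul_left (a := (aLast hp a : ℚ)) ?_ h2
        have h3 := mul_le_mul_of_nonneg_left hnD h1.le
        have h4 := mul_le_mul_of_nonneg_left hlt'.le h1.le
        have h5 := mul_le_mul_of_nonneg_right hge' hD.le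
        nlinarith [mul_pos h1 hD]
      rw [totalDiff]
      exact_mod_cast this
    · have : (m : ℚ) * aLast hp a - n * aFirst hp a + tailBound hp a ≤
          n * ((aLast hp a : ℚ) - aFirst hp a) := by linarith
      rw [totalDiff]
      exact_mod_cast this
  · rintro ⟨m, hm, rfl⟩
    obtain ⟨hm, hlt⟩ := (mem_B3_iff hp ha_pos).1 hm
    refine ⟨(mem_nu_comm hp).1 (add_mem_nu hp ((mem_nu_comm hp).1 hm) μ), ?_⟩
    push_cast
    linarith

end Zones

end Generators

end NumericalSemigroup

theorem mainTheorem3 {p : ℕ} (hp : 3 ≤ p) (a : Fin p → ℕ) (ha_pos : ∀ i, 0 < a i)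
    (ha_mono : StrictMono a) (ha_gcd : Finset.univ.gcd a = 1)
    (n : ℕ) (hn : NumericalSemigroup.N0 hp a ≤ (n : ℚ)) :
    (∀ μ : ℕ, NumericalSemigroup.delta (NumericalSemigroup.B1 hp a n) =
      NumericalSemigroup.delta
        (NumericalSemigroup.B1 hp a (n + μ * NumericalSemigroup.aFirst hp a))) ∧
    (∀ μ : ℕ, NumericalSemigroup.delta (NumericalSemigroup.B3 hp a n) =
      NumericalSemigroup.delta
        (NumericalSemigroup.B3 hp a (n + μ * NumericalSemigroup.aLast hp a))) ∧
    (∀ (i : Fin p) (μ : ℕ),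
      NumericalSemigroup.delta (NumericalSemigroup.B2 hp a n) =
        NumericalSemigroup.delta (NumericalSemigroup.B2 hp a (n + μ * a i)) ∧
      NumericalSemigroup.delta (NumericalSemigroup.B2 hp a n) = {NumericalSemigroup.d a}) := by
  have hN : ∀ k : ℕ, NumericalSemigroup.N0 hp a ≤ ((n + k : ℕ) : ℚ) := fun k =>
    hn.trans (by push_cast; linarith [(Nat.cast_nonneg k : (0 : ℚ) ≤ k)])
  refine ⟨fun μ => ?_, fun μ => ?_, fun i μ => ?_⟩
  · rw [NumericalSemigroup.B1_add hp ha_pos ha_mono hn, NumericalSemigroup.delta_image_add]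
  · rw [NumericalSemigroup.B3_add hp ha_pos ha_mono hn, NumericalSemigroup.delta_image_add]
  · rw [NumericalSemigroup.delta_B2 hp ha_pos ha_mono ha_gcd hn,
      NumericalSemigroup.delta_B2 hp ha_pos ha_mono ha_gcd (hN _)]
    exact ⟨rfl, rfl⟩
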